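/- Let $\mathcal A$ be the CAR algebra over $\ell^2(\mathbb Z)$, i.e. the C*-algebra of operators on the fermionic Fock space over $\ell^2(\mathbb Z)$ generated by the identity and the annihilation and creation operators $c(f), c^*(g)$, and let $a_x^+ = c^*(\delta_x)+c(\delta_x)$, $a_x^- = i(c^*(\delta_x)-c(\delta_x))$ $(x\in\mathbb Z)$ be the Majorana fermions. For a linear functional $\omega$ on $\mathcal A$ and a family $\tau=\{\tau_t\}_{t\in\mathbb R}$ of *-automorphisms of $\mathcal A$ put $a_x^\#(t)=\tau_t(a_x^\#)$. The pair $(\omega,\tau)$ is called quasi-free if $$\omega\big(a_{x_1}^{\#_1}(t_1)\cdots a_{x_{2n}}^{\#_{2n}}(t_{2n})\big)=\operatorname{pf}\big(\omega(a_{x_j}^{\#_j}(t_j)\,a_{x_k}^{\#_k}(t_k))\big)_{1\le j<k\le 2n}$$ for all $n\ge 1$, all $(x_j,\#_j)\in\mathbb Z\times\{\pm\}$ and all $t_j\in\mathbb R$; here the pfaffian of a triangular array is that of the skew-symmetric matrix with these entries above the diagonal. Let $K:[0,\infty)\to[0,\infty)$ be nondecreasing and let $\mu_0\in(0,\infty)$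 be such that $\sum_{\ell\ge 0}(1+\ell)e^{-\mu_0K(\ell)}<\infty$. Let $C\in(0,\infty)$. Then there is a constant $C'\in(0,\infty)$, depending only on $\mu_0$, $K$ and $C$, such that the following holds. **Theorem (Pfaffian bound).** Let $(\omega,\tau)$ be a quasi-free pair on $\mathcal A$ and let $M_0\in(0,\infty)$ be such that $|\omega(A)|\le M_0\|A\|$ for all $A\in\mathcal A$. Let $I\subset\mathbb R$ and $\mu\in(\mu_0,\infty)$ be such that for all $x,y\in\mathbb Z$ $$\max_{\#,\flat\in\{\pm\}}\ \sup_{s,t\in I}\big|\omega\big(a_x^\#(t)\,a_y^\flat(s)\big)\big|\le C\,e^{-\mu K(|x-y|)}.$$ Then for every $n\ge1$ and every Majorana configuration, i.e. every family of pairwise distinct $(x_1,\#_1),\dots,(x_{2n},\#_{2n})\in\mathbb Z\times\{\pm\}$, $$\sup_{t\in I^{2n}}\Big|\operatorname{pf}\big(\omega(a_{x_j}^{\#_j}(t_j)\,a_{x_k}^{\#_k}(t_k))\big)_{1\le j<k\le 2n}\Big|\le M_0\,C'\,e^{-(\mu-\mu_0)K(r(x))},$$ where $r(x)=\max_{1\le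 j\le n}|x_{(2j)}-x_{(2j-1)}|$ and $x_{(1)}\le x_{(2)}\le\dots\le x_{(2n)}$ is the nondecreasing rearrangement of $x_1,\dots,x_{2n}$ (so $r(x)=\max_j|x_{2j}-x_{2j-1}|$ if the configuration is ordered). -/

import Mathlib

open scoped NNReal

noncomputable section

namespace CAR

/-- The one-particle Hilbert space `ℓ²(ℤ)`. -/
abbrev OneParticle : Type := lp (fun _ : ℤ => ℂ) 2

/-- The fermionic Fock space over `ℓ²(ℤ)` in the occupation number representation: the Hilbert
space with orthonormal basis `e_S`, `S` a finite subset of `ℤ`, where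
`e_S = δ_{x₁} ∧ ⋯ ∧ δ_{xₖ}` for `S = {x₁ < ⋯ < xₖ}`. -/
abbrev Fock : Type := lp (fun _ : Finset ℤ => ℂ) 2

/-- The sign `(-1)^{#{y ∈ S : y < x}}`: for `x ∉ S` one has `δ_x ∧ e_S = sgn x S • e_{S ∪ {x}}`. -/
def sgn (x : ℤ) (S : Finset ℤ) : ℂ := (-1) ^ (S.filter (· < x)).card

/-- The coefficients of `g ∧ ψ` in the basis `e_S`. -/
def wedge (g : ℤ → ℂ) (ψ : Finset ℤ → ℂ) (S : Finset ℤ) : ℂ :=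
  ∑ x ∈ S, sgn x S * g x * ψ (S.erase x)

/-! ### Boundedness of the creation operators -/

lemma sgn_mul_self (x : ℤ) (S : Finset ℤ) : sgn x S * sgn x S = 1 := by
  unfold sgn; rw [← mul_pow]; simp

lemma conj_sgn (x : ℤ) (S : Finset ℤ) : (starRingEnd ℂ) (sgn x S) = sgn x S := by
  unfold sgn; simp

lemma norm_sgn (x : ℤ) (S : Finset ℤ) : ‖sgn x S‖ = 1 := by
  unfold sgn; simp

/-- Adding or removing the point `x`. -/
def toggle (x : ℤ) : Equiv.Perm (Finset ℤ) where
  toFun S := if x ∈ S then S.erase x else insert x S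
  invFun S := if x ∈ S then S.erase x else insert x S
  left_inv S := by by_cases h : x ∈ S <;> simp [h]
  right_inv S := by by_cases h : x ∈ S <;> simp [h]

lemma toggle_of_mem {x : ℤ} {S : Finset ℤ} (h : x ∈ S) : toggle x S = S.erase x := by
  simp [toggle, h]

lemma mem_toggle (x y : ℤ) (S : Finset ℤ) :
    x ∈ toggle y S ↔ (x = y ∧ x ∉ S) ∨ (x ≠ y ∧ x ∈ S) := by
  by_cases h : y ∈ S
  · simp only [toggle, Equiv.coe_fn_mk, h, if_true, Finset.mem_erase]
    by_cases hx : x = y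
    · subst hx; simp [h]
    · simp [hx]
  · simp only [toggle, Equiv.coe_fn_mk, h, if_false, Finset.mem_insert]
    by_cases hx : x = y
    · subst hx; simp [h]
    · simp [hx]

lemma toggle_toggle (x : ℤ) (S : Finset ℤ) : toggle x (toggle x S) = S :=
  (toggle x).left_inv S

lemma toggle_comm (x y : ℤ) (S : Finset ℤ) :
    toggle x (toggle y S) = toggle y (toggle x S) := by
  ext z
  simp only [mem_toggle]
  tauto

lemma sgn_toggle (x y : ℤ) (S : Finset ℤ) :
    sgn x (toggle y S) = if y < x then - sgn x S else sgn x S := by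
  unfold sgn
  by_cases h : y ∈ S
  · rw [toggle_of_mem h, Finset.filter_erase]
    split_ifs with hlt
    · have hm : y ∈ S.filter (· < x) := by simp [h, hlt]
      have := Finset.card_erase_add_one hm
      rw [← this, pow_succ]; simp
    · rw [Finset.erase_eq_of_notMem]; simp [hlt]
  · have ht : toggle y S = insert y S := by simp [toggle, h]
    rw [ht, Finset.filter_insert]
    split_ifs with hlt
    · rw [Finset.card_insert_of_notMem (by simp [h]), pow_succ]; simp
    · rfl

lemma two_toReal : (2 : ENNReal).toReal = 2 := by norm_num

lemma summable_sq (ψ : Fock) : Summable fun S => ‖ψ S‖ ^ (2 : ℝ) := by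
  have := (memℓp_gen_iff (p := 2) (by norm_num)).1 (lp.memℓp ψ)
  simpa using this

lemma norm_sq (ψ : Fock) : ‖ψ‖ ^ (2 : ℝ) = ∑' S, ‖ψ S‖ ^ (2 : ℝ) := by
  have := lp.norm_rpow_eq_tsum (p := 2) (by norm_num) ψ
  simpa using this

/-- The operator `(Tψ)(S) = w(S) ψ(toggle x S)` for weights `w` bounded by one. -/
def weighted (x : ℤ) (w : Finset ℤ → ℂ) (hw : ∀ S, ‖w S‖ ≤ 1) : Fock →L[ℂ] Fock :=
  have hle : ∀ (ψ : Fock) S, ‖w S * ψ (toggle x S)‖ ^ (2 : ℝ) ≤ ‖ψ (toggle x S)‖ ^ (2 : ℝ) := by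
    intro ψ S
    refine Real.rpow_le_rpow (norm_nonneg _) ?_ (by norm_num)
    rw [norm_mul]
    exact mul_le_of_le_one_left (norm_nonneg _) (hw S)
  have hs : ∀ ψ : Fock, Summable fun S => ‖ψ (toggle x S)‖ ^ (2 : ℝ) := fun ψ =>
    (Equiv.summable_iff (toggle x)).2 (summable_sq ψ)
  have hsum : ∀ ψ : Fock, Summable fun S => ‖w S * ψ (toggle x S)‖ ^ (2 : ℝ) := fun ψ =>
    Summable.of_nonneg_of_le (fun S => by positivity) (hle ψ) (hs ψ)
  LinearMap.mkContinuous
    { toFun := fun ψ => ⟨fun S => w S * ψ (toggle x S), by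
        refine memℓp_gen ?_
        simpa using hsum ψ⟩
      map_add' := fun ψ φ => by ext S; exact mul_add _ _ _
      map_smul' := fun c ψ => by ext S; simp [mul_left_comm] }
    1 (fun ψ => by
      rw [one_mul]
      refine (Real.rpow_le_rpow_iff (norm_nonneg _) (norm_nonneg _)
        (by norm_num : (0 : ℝ) < 2)).1 ?_
      rw [norm_sq, norm_sq, ← Equiv.tsum_eq (toggle x) (fun S => ‖ψ S‖ ^ (2 : ℝ))]
      exact Summable.tsum_le_tsum (hle ψ) (hsum ψ) (hs ψ))

lemma weighted_apply (x : ℤ) (w : Finset ℤ → ℂ) (hw : ∀ S, ‖w S‖ ≤ 1) (ψ : Fock)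
    (S : Finset ℤ) : weighted x w hw ψ S = w S * ψ (toggle x S) := rfl

/-- Creation of a particle at the site `x`. -/
def cr (x : ℤ) : Fock →L[ℂ] Fock :=
  weighted x (fun S => if x ∈ S then sgn x S else 0)
    (fun S => by split_ifs <;> simp [norm_sgn])

/-- Annihilation of a particle at the site `x`. -/
def an (x : ℤ) : Fock →L[ℂ] Fock :=
  weighted x (fun S => if x ∈ S then 0 else sgn x S)
    (fun S => by split_ifs <;> simp [norm_sgn])

lemma cr_apply (x : ℤ) (ψ : Fock) (S : Finset ℤ) :
    cr x ψ S = (if x ∈ S then sgn x S else 0) * ψ (toggle x S) := rfl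

lemma an_apply (x : ℤ) (ψ : Fock) (S : Finset ℤ) :
    an x ψ S = (if x ∈ S then 0 else sgn x S) * ψ (toggle x S) := rfl

lemma star_cr (x : ℤ) : star (cr x) = an x := by
  rw [ContinuousLinearMap.star_eq_adjoint]
  refine ((ContinuousLinearMap.eq_adjoint_iff _ _).2 fun ψ φ => ?_).symm
  rw [lp.inner_eq_tsum, lp.inner_eq_tsum, ← Equiv.tsum_eq (toggle x)]
  refine tsum_congr fun S => ?_
  rw [an_apply, cr_apply, toggle_toggle, sgn_toggle]
  by_cases h : x ∈ S
  · simp [mem_toggle, h, conj_sgn]; ring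
  · simp [mem_toggle, h]

lemma an_cr (x y : ℤ) : an x * cr y + cr y * an x = if x = y then 1 else 0 := by
  ext ψ S
  have h1 : (an x * cr y + cr y * an x) ψ S = an x (cr y ψ) S + cr y (an x ψ) S := rfl
  rw [h1]
  simp only [an_apply, cr_apply, toggle_comm x y, sgn_toggle, mem_toggle]
  by_cases hxy : x = y
  · subst hxy
    by_cases hx : x ∈ S
    · simp [hx, toggle_toggle, ← mul_assoc, sgn_mul_self]
    · simp [hx, toggle_toggle, ← mul_assoc, sgn_mul_self]
  · have hyx : y ≠ x := fun h => hxy h.symm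
    by_cases hx : x ∈ S
    · simp [hx, hxy]
    · by_cases hy : y ∈ S
      · rcases lt_or_gt_of_ne hxy with h | h
        · simp [hx, hy, hxy, hyx, h, h.not_gt]; ring
        · simp [hx, hy, hxy, hyx, h, h.not_gt]; ring
      · simp [hx, hy, hxy, hyx]

lemma cr_cr (x y : ℤ) : cr x * cr y + cr y * cr x = 0 := by
  ext ψ S
  have h1 : (cr x * cr y + cr y * cr x) ψ S = cr x (cr y ψ) S + cr y (cr x ψ) S := rfl
  rw [h1]
  simp only [cr_apply, toggle_comm x y, sgn_toggle, mem_toggle]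
  by_cases hxy : x = y
  · subst hxy
    by_cases hx : x ∈ S <;> simp [hx]
  · have hyx : y ≠ x := fun h => hxy h.symm
    by_cases hx : x ∈ S
    · by_cases hy : y ∈ S
      · rcases lt_or_gt_of_ne hxy with h | h
        · simp [hx, hy, hxy, hyx, h, h.not_gt]; ring
        · simp [hx, hy, hxy, hyx, h, h.not_gt]; ring
      · simp [hx, hy, hxy, hyx]
    · simp [hx, hxy]

lemma finite_bound (Λ : Finset ℤ) (g : ℤ → ℂ) (ψ : Fock) :
    ‖(∑ x ∈ Λ, g x • cr x) ψ‖ ^ 2 ≤ (∑ x ∈ Λ, ‖g x‖ ^ 2) * ‖ψ‖ ^ 2 := by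
  set A : Fock →L[ℂ] Fock := ∑ x ∈ Λ, g x • cr x with hA
  have hstar : star A = ∑ x ∈ Λ, (starRingEnd ℂ) (g x) • an x := by
    simp [hA, star_sum, star_smul, star_cr]
  have hcar : star A * A + A * star A = ((∑ x ∈ Λ, ‖g x‖ ^ 2 : ℝ) : ℂ) • 1 := by
    rw [hstar, hA, Finset.sum_mul_sum, Finset.sum_mul_sum, Finset.sum_comm (s := Λ) (t := Λ)
      (f := fun i j => g i • cr i * (starRingEnd ℂ) (g j) • an j), ← Finset.sum_add_distrib]
    push_cast
    rw [Finset.sum_smul]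
    refine Finset.sum_congr rfl fun x hx => ?_
    rw [← Finset.sum_add_distrib]
    have : ∀ y ∈ Λ, (starRingEnd ℂ) (g x) • an x * g y • cr y
        + g y • cr y * (starRingEnd ℂ) (g x) • an x
        = if x = y then ((‖g x‖ : ℂ) ^ 2) • (1 : Fock →L[ℂ] Fock) else 0 := by
      intro y _
      rw [smul_mul_smul_comm, smul_mul_smul_comm, mul_comm (g y), ← smul_add, an_cr]
      split_ifs with h
      · subst h; rw [mul_comm, Complex.mul_conj']
      · simp
    rw [Finset.sum_congr rfl this]
    simp [hx]
  have h1 : (‖A ψ‖ ^ 2 : ℝ) + ‖star A ψ‖ ^ 2 = (∑ x ∈ Λ, ‖g x‖ ^ 2) * ‖ψ‖ ^ 2 := by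
    have h2 := congrArg (fun B : Fock →L[ℂ] Fock => inner ℂ ψ (B ψ)) hcar
    have h3 : inner ℂ ψ ((star A * A + A * star A) ψ)
        = ((‖A ψ‖ ^ 2 + ‖star A ψ‖ ^ 2 : ℝ) : ℂ) := by
      have h4 : (star A * A + A * star A) ψ = star A (A ψ) + A (star A ψ) := rfl
      rw [h4, inner_add_right]
      rw [ContinuousLinearMap.star_eq_adjoint, ContinuousLinearMap.adjoint_inner_right,
        ← ContinuousLinearMap.adjoint_inner_left A _ ψ, inner_self_eq_norm_sq_to_K,
        inner_self_eq_norm_sq_to_K]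
      push_cast; rfl
    have h5 : inner ℂ ψ ((((∑ x ∈ Λ, ‖g x‖ ^ 2 : ℝ) : ℂ) • (1 : Fock →L[ℂ] Fock)) ψ)
        = (((∑ x ∈ Λ, ‖g x‖ ^ 2) * ‖ψ‖ ^ 2 : ℝ) : ℂ) := by
      have h6 : (((∑ x ∈ Λ, ‖g x‖ ^ 2 : ℝ) : ℂ) • (1 : Fock →L[ℂ] Fock)) ψ
        = ((∑ x ∈ Λ, ‖g x‖ ^ 2 : ℝ) : ℂ) • ψ := rfl
      rw [h6, inner_smul_right, inner_self_eq_norm_sq_to_K]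
      push_cast; rfl
    simp only [h3, h5] at h2
    exact_mod_cast h2
  nlinarith [sq_nonneg ‖star A ψ‖]

lemma finite_apply (Λ : Finset ℤ) (g : ℤ → ℂ) (ψ : Fock) (S : Finset ℤ) (hS : S ⊆ Λ) :
    ((∑ x ∈ Λ, g x • cr x) ψ) S = wedge g ψ S := by
  have h1 : ((∑ x ∈ Λ, g x • cr x) ψ) S = ∑ x ∈ Λ, g x * cr x ψ S := by
    rw [sum_apply, lp.coeFn_sum, Finset.sum_apply]
    rfl
  rw [h1, wedge, ← Finset.sum_subset hS]
  · refine Finset.sum_congr rfl fun x hx => ?_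
    rw [cr_apply, if_pos hx, toggle_of_mem hx]; ring
  · intro x _ hx
    rw [cr_apply, if_neg hx]; simp

lemma wedge_sum_le (g : OneParticle) (ψ : Fock) (T : Finset (Finset ℤ)) :
    ∑ S ∈ T, ‖wedge g ψ S‖ ^ (2 : ENNReal).toReal ≤ (‖g‖ * ‖ψ‖) ^ (2 : ENNReal).toReal := by
  have hp : (0 : ℝ) < (2 : ENNReal).toReal := by norm_num
  have h1 : ∀ S ∈ T, wedge g ψ S = ((∑ x ∈ T.biUnion id, g x • cr x) ψ) S := fun S hS =>
    (finite_apply _ g ψ S (Finset.subset_biUnion_of_mem id hS)).symm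
  rw [Finset.sum_congr rfl fun S hS => by rw [h1 S hS]]
  refine (lp.sum_rpow_le_norm_rpow hp _ T).trans ?_
  have h2 := finite_bound (T.biUnion id) g ψ
  have h3 := lp.sum_rpow_le_norm_rpow hp g (T.biUnion id)
  simp only [two_toReal, Real.rpow_two] at h3 ⊢
  rw [mul_pow]
  exact h2.trans (mul_le_mul_of_nonneg_right h3 (sq_nonneg _))

/-- The creation operators `c*(g) ψ = g ∧ ψ`, as a continuous linear function of `g ∈ ℓ²(ℤ)` with
values in the bounded operators on Fock space. -/
def creation : OneParticle →L[ℂ] Fock →L[ℂ] Fock :=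
  LinearMap.mkContinuous₂
    (LinearMap.mk₂ ℂ
      (fun (g : OneParticle) (ψ : Fock) =>
        (⟨wedge g ψ, memℓp_gen' (wedge_sum_le g ψ)⟩ : Fock))
      (fun g h ψ => by
        ext S
        change _ = wedge g ψ S + wedge h ψ S
        simp [wedge, mul_add, add_mul, Finset.sum_add_distrib])
      (fun a g ψ => by
        ext S; simp [wedge, Finset.mul_sum, mul_assoc, mul_left_comm])
      (fun g ψ φ => by
        ext S
        change _ = wedge g ψ S + wedge g φ S
        simp [wedge, mul_add, Finset.sum_add_distrib])
      (fun a g ψ => by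
        ext S; simp [wedge, Finset.mul_sum, mul_assoc, mul_left_comm]))
    1 (fun g ψ => by
      rw [one_mul]
      exact lp.norm_le_of_forall_sum_le (by norm_num) (by positivity) (wedge_sum_le g ψ))

lemma creation_apply (g : OneParticle) (ψ : Fock) (S : Finset ℤ) :
    creation g ψ S = ∑ x ∈ S, sgn x S * g x * ψ (S.erase x) := rfl

/-- The annihilation operator `c(f)`, the adjoint of `c*(f)`. -/
def annihilation (f : OneParticle) : Fock →L[ℂ] Fock := star (creation f)

/-! ### The canonical anticommutation relations -/

/-- The canonical basis vector `δ_x` of `ℓ²(ℤ)`. -/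
def delta (x : ℤ) : OneParticle := lp.single 2 x 1

lemma creation_delta (x : ℤ) : creation (delta x) = cr x := by
  ext ψ S
  rw [creation_apply, cr_apply]
  by_cases h : x ∈ S
  · rw [Finset.sum_eq_single_of_mem x h, if_pos h, toggle_of_mem h]
    · simp [delta]
    · intro y _ hy
      simp [delta, hy]
  · rw [if_neg h, zero_mul]
    refine Finset.sum_eq_zero fun y hy => ?_
    have : y ≠ x := fun e => h (e ▸ hy)
    simp [delta, this]

lemma annihilation_delta (x : ℤ) : annihilation (delta x) = an x := by
  rw [annihilation, creation_delta, star_cr]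

lemma ext_delta {E : Type*} [NormedAddCommGroup E] [NormedSpace ℂ E]
    {F G : OneParticle →L[ℂ] E} (h : ∀ x, F (delta x) = G (delta x)) : F = G := by
  refine lp.ext_continuousLinearMap (by norm_num) fun x => ?_
  ext
  simpa [delta] using h x

/-- `{c*(f), c*(g)} = 0`. -/
theorem creation_anticomm (f g : OneParticle) :
    creation f * creation g + creation g * creation f = 0 := by
  let B : OneParticle →L[ℂ] OneParticle →L[ℂ] (Fock →L[ℂ] Fock) :=
    (ContinuousLinearMap.mul ℂ (Fock →L[ℂ] Fock)).bilinearComp creation creation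
  have h : B + B.flip = 0 := by
    refine ext_delta fun x => ext_delta fun y => ?_
    change creation (delta x) * creation (delta y) + creation (delta y) * creation (delta x) = 0
    rw [creation_delta, creation_delta, cr_cr]
  exact congrArg (fun D => D f g) h

/-- `{c(f), c(g)} = 0`. -/
theorem annihilation_anticomm (f g : OneParticle) :
    annihilation f * annihilation g + annihilation g * annihilation f = 0 := by
  have := congrArg star (creation_anticomm g f)
  simpa [annihilation] using this

/-- `{c(f), c*(g)} = ⟨f, g⟩ 1`. -/
theorem annihilation_creation_anticomm (f g : OneParticle) :
    annihilation f * creation g + creation g * annihilation f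
      = inner ℂ f g • (1 : Fock →L[ℂ] Fock) := by
  have key : ∀ x, ∀ g : OneParticle, an x * creation g + creation g * an x
      = inner ℂ (delta x) g • (1 : Fock →L[ℂ] Fock) := by
    intro x g
    let M := ContinuousLinearMap.mul ℂ (Fock →L[ℂ] Fock)
    have h : (M (an x)).comp creation + (M.flip (an x)).comp creation
        = (innerSL ℂ (delta x)).smulRight (1 : Fock →L[ℂ] Fock) := by
      refine ext_delta fun y => ?_
      change an x * creation (delta y) + creation (delta y) * an x = inner ℂ (delta x) (delta y) • 1
      rw [creation_delta, an_cr, delta, delta, lp.inner_single_left]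
      by_cases hxy : x = y
      · subst hxy; simp
      · simp [hxy]
    exact congrArg (fun D => D g) h
  have h2 : ∀ f : OneParticle, annihilation g * creation f + creation f * annihilation g
      = inner ℂ g f • (1 : Fock →L[ℂ] Fock) := by
    intro f
    let M := ContinuousLinearMap.mul ℂ (Fock →L[ℂ] Fock)
    have h : (M (annihilation g)).comp creation + (M.flip (annihilation g)).comp creation
        = (innerSL ℂ g).smulRight (1 : Fock →L[ℂ] Fock) := by
      refine ext_delta fun y => ?_
      change annihilation g * creation (delta y) + creation (delta y) * annihilation g
        = inner ℂ g (delta y) • 1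
      have := congrArg star (key y g)
      rw [creation_delta]
      rw [← star_cr] at this
      simpa [annihilation, add_comm] using this
    exact congrArg (fun D => D f) h
  have := congrArg star (h2 f)
  simpa [annihilation] using this

/-! ### The CAR algebra, Majorana fermions and quasi-free pairs -/

/-- The CAR algebra over `ℓ²(ℤ)`: the C*-algebra of operators on Fock space generated by the
identity and all `c(f)`, `c*(g)`. -/
def carAlgebra : StarSubalgebra ℂ (Fock →L[ℂ] Fock) :=
  (StarAlgebra.adjoin ℂ (Set.range annihilation ∪ Set.range creation)).topologicalClosure

lemma annihilation_mem (f : OneParticle) : annihilation f ∈ carAlgebra :=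
  StarSubalgebra.le_topologicalClosure _
    (StarAlgebra.subset_adjoin ℂ _ (Or.inl (Set.mem_range_self f)))

lemma creation_mem (f : OneParticle) : creation f ∈ carAlgebra :=
  StarSubalgebra.le_topologicalClosure _
    (StarAlgebra.subset_adjoin ℂ _ (Or.inr (Set.mem_range_self f)))

/-- The two flavours `#` of Majorana fermions. -/
inductive Flavor : Type
  | plus
  | minus

/-- The Majorana fermions `a_x^+ = c*(δ_x) + c(δ_x)` and `a_x^- = i (c*(δ_x) - c(δ_x))`. -/
def majorana : ℤ × Flavor → carAlgebra
  | (x, Flavor.plus) =>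
      ⟨creation (delta x) + annihilation (delta x),
        add_mem (creation_mem _) (annihilation_mem _)⟩
  | (x, Flavor.minus) =>
      ⟨Complex.I • (creation (delta x) - annihilation (delta x)),
        SMulMemClass.smul_mem _ (sub_mem (creation_mem _) (annihilation_mem _))⟩

/-- The pfaffian of a skew-symmetric `2n × 2n` matrix,
`(2ⁿ n!)⁻¹ ∑_π sgn π ∏_{j<n} M_{π(2j), π(2j+1)}` (indices starting from `0`). -/
def pfaffian {n : ℕ} (M : Matrix (Fin (2 * n)) (Fin (2 * n)) ℂ) : ℂ :=
  (2 ^ n * (n.factorial : ℂ))⁻¹ *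
    ∑ π : Equiv.Perm (Fin (2 * n)), ((Equiv.Perm.sign π : ℤ) : ℂ) *
      ∏ j : Fin n, M (π ⟨2 * j, by omega⟩) (π ⟨2 * j + 1, by omega⟩)

/-- The skew-symmetric matrix whose entries above the diagonal are the `a j k`, `j < k`. -/
def skew {m : ℕ} (a : Fin m → Fin m → ℂ) : Matrix (Fin m) (Fin m) ℂ :=
  Matrix.of fun j k => if j < k then a j k else if k < j then - a k j else 0

/-- The pfaffian of the triangular array of the two-point functions
`ω(a_{x_j}^{#_j}(t_j) a_{x_k}^{#_k}(t_k))`, `j < k`, where `ξ j = (x_j, #_j)`. -/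
def pfCorrelation (ω : carAlgebra →ₗ[ℂ] ℂ) (τ : ℝ → carAlgebra ≃⋆ₐ[ℂ] carAlgebra) {n : ℕ}
    (ξ : Fin (2 * n) → ℤ × Flavor) (t : Fin (2 * n) → ℝ) : ℂ :=
  pfaffian (skew fun j k => ω (τ (t j) (majorana (ξ j)) * τ (t k) (majorana (ξ k))))

/-- The pair `(ω, τ)` of a linear functional and a family of automorphisms of the CAR algebra is
quasi-free: all time-dependent Majorana correlations are given by Wick's theorem. -/
def IsQuasiFree (ω : carAlgebra →ₗ[ℂ] ℂ) (τ : ℝ → carAlgebra ≃⋆ₐ[ℂ] carAlgebra) : Prop :=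
  ∀ n : ℕ, 1 ≤ n → ∀ (ξ : Fin (2 * n) → ℤ × Flavor) (t : Fin (2 * n) → ℝ),
    ω (List.ofFn fun j => τ (t j) (majorana (ξ j))).prod = pfCorrelation ω τ ξ t

/-- `r(x) = max_j |x_{2j} - x_{2j-1}|` (indices starting from `1`), where the points are first
brought into nondecreasing order `x_1 ≤ x_2 ≤ ⋯ ≤ x_{2n}`. -/
def pairDist {n : ℕ} (x : Fin (2 * n) → ℤ) : ℕ :=
  Finset.univ.sup fun j : Fin n =>
    (x (Tuple.sort x ⟨2 * j + 1, by omega⟩) - x (Tuple.sort x ⟨2 * j, by omega⟩)).natAbs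

end CAR

end

noncomputable section

namespace CAR

open Equiv Finset

/-! ### Sums over permutations of products over consecutive pairs -/

/-! Choose a gap of length r(x) between consecutive sorted points with an odd number of points on
its left (`exists_gap`). If the correlations across the gap are deleted, the matrix decouples into
two blocks of odd size, so its pfaffian is zero (`pfaffian_eq_zero_of_odd`). The pfaffian to be
bounded is therefore only the error made by this deletion.

For the error, write the deletion as `M + Z` and expand over the pairs that use `Z`. Once k such
pairs are chosen, what remains is a sub-pfaffian of `M`. By Wick's theorem it is, up to sign, `ω` of
a product of contractions, hence at most M₀, whatever its size. Counting the choices bounds the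
error by M₀ ∑_{k≥1} sᵏ/k!, where 2s is the sum of |Z p q| (`norm_pfaffian_add_sub_le`); this bound
does not grow with n.

Two points at distances summing to l from the two ends of the gap lie r + l apart, and at most 4(l +
1) pairs of distinct modes share the same l. Splitting μ = (μ - μ₀) + μ₀ gives s ≤ εκ with ε =
exp(-(μ - μ₀)K(r)) and κ = 4C ∑ (1 + l) exp(-μ₀K(l)). Since ε ≤ 1, the error is at most M₀ ε exp κ.
-/

/-- `∑_π sgn π ∏_j M_j(π(2j), π(2j+1))`: the unnormalized pfaffian with a separate matrix for each
of the pairs. -/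
def pairSum {n : ℕ} (M : Fin n → Matrix (Fin (2 * n)) (Fin (2 * n)) ℂ) : ℂ :=
  ∑ π : Perm (Fin (2 * n)), ((Perm.sign π : ℤ) : ℂ) *
    ∏ j : Fin n, M j (π ⟨2 * j, by omega⟩) (π ⟨2 * j + 1, by omega⟩)

lemma pfaffian_eq_pairSum {n : ℕ} (M : Matrix (Fin (2 * n)) (Fin (2 * n)) ℂ) :
    pfaffian M = (2 ^ n * (n.factorial : ℂ))⁻¹ * pairSum fun _ => M := rfl

lemma pairSum_const {n : ℕ} (M : Matrix (Fin (2 * n)) (Fin (2 * n)) ℂ) :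
    (pairSum fun _ => M) = 2 ^ n * (n.factorial : ℂ) * pfaffian M := by
  rw [pfaffian_eq_pairSum, mul_inv_cancel_left₀]
  exact mul_ne_zero (pow_ne_zero _ two_ne_zero) (Nat.cast_ne_zero.2 n.factorial_ne_zero)

lemma norm_intCast_sign {α : Type*} [Fintype α] [DecidableEq α] (π : Perm α) :
    ‖((Perm.sign π : ℤ) : ℂ)‖ = 1 := by
  rcases Int.units_eq_one_or (Perm.sign π) with h | h <;> simp [h]

/-- Reindexing the entries changes the pfaffian by a sign only. -/
lemma norm_pfaffian_submatrix_perm {n : ℕ} (M : Matrix (Fin (2 * n)) (Fin (2 * n)) ℂ)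
    (σ : Perm (Fin (2 * n))) : ‖pfaffian (M.submatrix σ σ)‖ = ‖pfaffian M‖ := by
  have h : (pairSum fun _ : Fin n => M)
      = ((Perm.sign σ : ℤ) : ℂ) * pairSum fun _ : Fin n => M.submatrix σ σ := by
    rw [pairSum, pairSum, ← Equiv.sum_comp (Equiv.mulLeft σ), mul_sum]
    refine sum_congr rfl fun π _ => ?_
    simp [mul_assoc]
  rw [pfaffian_eq_pairSum, pfaffian_eq_pairSum, h, norm_mul, norm_mul, norm_mul,
    norm_intCast_sign, one_mul]

/-- The order of the pairs does not matter. -/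
lemma pairSum_swap {n : ℕ} (M : Fin n → Matrix (Fin (2 * n)) (Fin (2 * n)) ℂ) (k l : Fin n) :
    (pairSum fun j => M (swap k l j)) = pairSum M := by
  rcases eq_or_ne k l with rfl | hkl
  · simp
  have hkl' : (k : ℕ) ≠ l := fun h => hkl (Fin.ext h)
  -- Exchanging two whole pairs takes two disjoint transpositions, so the permutation is even and no
  -- sign appears.
  set ρ : Perm (Fin (2 * n)) := swap ⟨2 * k, by omega⟩ ⟨2 * l, by omega⟩
    * swap ⟨2 * k + 1, by omega⟩ ⟨2 * l + 1, by omega⟩ with hρ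
  have hs : Perm.sign ρ = 1 := by
    rw [hρ, Perm.sign_mul, Perm.sign_swap, Perm.sign_swap]
    · rfl
    · simpa [Fin.ext_iff] using hkl'
    · simpa [Fin.ext_iff] using hkl'
  have h0 : ∀ j : Fin n, ρ ⟨2 * j, by omega⟩ = ⟨2 * (swap k l j : Fin n), by omega⟩ := by
    intro j
    have h1 : swap (⟨2 * k + 1, by omega⟩ : Fin (2 * n)) ⟨2 * l + 1, by omega⟩ ⟨2 * j, by omega⟩
        = ⟨2 * j, by omega⟩ :=
      swap_apply_of_ne_of_ne (by simp only [ne_eq, Fin.mk.injEq]; omega)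
        (by simp only [ne_eq, Fin.mk.injEq]; omega)
    rw [hρ, Perm.mul_apply, h1]
    simp only [swap_apply_def, Fin.ext_iff]
    split_ifs <;> first | rfl | (simp only; omega)
  have h1 : ∀ j : Fin n, ρ ⟨2 * j + 1, by omega⟩ = ⟨2 * (swap k l j : Fin n) + 1, by omega⟩ := by
    intro j
    have : swap (⟨2 * k + 1, by omega⟩ : Fin (2 * n)) ⟨2 * l + 1, by omega⟩ ⟨2 * j + 1, by omega⟩
        = ⟨2 * (swap k l j : Fin n) + 1, by omega⟩ := by
      simp only [swap_apply_def, Fin.ext_iff]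
      split_ifs <;> first | rfl | (simp only; omega)
    rw [hρ, Perm.mul_apply, this, swap_apply_of_ne_of_ne]
      <;> (simp only [ne_eq, Fin.mk.injEq]; omega)
  rw [pairSum, pairSum, ← Equiv.sum_comp (Equiv.mulRight ρ)]
  refine sum_congr rfl fun π _ => ?_
  simp only [coe_mulRight, Perm.sign_mul, hs, mul_one, Perm.mul_apply, h0, h1]
  congr 1
  rw [← Equiv.prod_comp (swap k l)]
  simp

/-- The injection left over when the first two places are taken by `p` and `swap 0 p q.succ`. -/
def skipPair {n : ℕ} (p : Fin (n + 2)) (q : Fin (n + 1)) (i : Fin n) : Fin (n + 2) :=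
  swap 0 p (swap 0 q i.succ).succ

lemma skipPair_injective {n : ℕ} (p : Fin (n + 2)) (q : Fin (n + 1)) :
    Function.Injective (skipPair p q) := fun i j h => by simpa [skipPair] using h

/-- Expansion with respect to the first pair. -/
lemma pairSum_succ {n : ℕ} (M : Fin (n + 1) → Matrix (Fin (2 * n + 2)) (Fin (2 * n + 2)) ℂ) :
    pairSum (n := n + 1) M = ∑ p : Fin (2 * n + 2), ∑ q : Fin (2 * n + 1),
      (if p = 0 then 1 else -1) * (if q = 0 then 1 else -1) * M 0 p (swap 0 p q.succ) *
        pairSum fun j => (M j.succ).submatrix (skipPair p q) (skipPair p q) := by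
  -- Peeling off a permutation twice: `p` is the image of place 0, `q` encodes the image of place 1,
  -- and `e` permutes the remaining places.
  have h : ∀ f : Perm (Fin (2 * n + 2)) → ℂ, ∑ π, f π = ∑ p, ∑ q, ∑ e : Perm (Fin (2 * n)),
      f (Perm.decomposeFin.symm (p, Perm.decomposeFin.symm (q, e))) := by
    intro f
    rw [← (Perm.decomposeFin (n := 2 * n + 1)).symm.sum_comp, Fintype.sum_prod_type]
    refine sum_congr rfl fun p _ => ?_
    rw [← (Perm.decomposeFin (n := 2 * n)).symm.sum_comp, Fintype.sum_prod_type]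
  refine (h _).trans (sum_congr rfl fun p _ => sum_congr rfl fun q _ => ?_)
  rw [pairSum, mul_sum]
  refine sum_congr rfl fun e _ => ?_
  rw [Fin.prod_univ_succ]
  have e0 : Perm.decomposeFin.symm (p, Perm.decomposeFin.symm (q, e))
      ⟨2 * ((0 : Fin (n + 1)) : ℕ), by omega⟩ = p :=
    Perm.decomposeFin_symm_apply_zero _ _
  have e1 : Perm.decomposeFin.symm (p, Perm.decomposeFin.symm (q, e))
      ⟨2 * ((0 : Fin (n + 1)) : ℕ) + 1, by omega⟩ = swap 0 p q.succ := by
    refine (Perm.decomposeFin_symm_apply_succ _ p 0).trans ?_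
    rw [Perm.decomposeFin_symm_apply_zero]
  have es : ∀ i : Fin (2 * n), Perm.decomposeFin.symm (p, Perm.decomposeFin.symm (q, e))
      i.succ.succ = skipPair p q (e i) := fun i => by
    rw [Perm.decomposeFin_symm_apply_succ, Perm.decomposeFin_symm_apply_succ, skipPair]
  have e2 : ∀ j : Fin n, Perm.decomposeFin.symm (p, Perm.decomposeFin.symm (q, e))
      ⟨2 * (j.succ : ℕ), by omega⟩ = skipPair p q (e ⟨2 * j, by omega⟩) := fun j =>
    es ⟨2 * j, by omega⟩
  have e3 : ∀ j : Fin n, Perm.decomposeFin.symm (p, Perm.decomposeFin.symm (q, e))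
      ⟨2 * (j.succ : ℕ) + 1, by omega⟩ = skipPair p q (e ⟨2 * j + 1, by omega⟩) := fun j =>
    es ⟨2 * j + 1, by omega⟩
  rw [e0, e1, prod_congr rfl fun j _ => by rw [e2 j, e3 j]]
  have hs : ((Perm.sign (Perm.decomposeFin.symm (p, Perm.decomposeFin.symm (q, e))) : ℤ) : ℂ)
      = (if p = 0 then 1 else -1) * (if q = 0 then 1 else -1) * ((Perm.sign e : ℤ) : ℂ) := by
    rw [Perm.decomposeFin.symm_sign, Perm.decomposeFin.symm_sign]
    split_ifs <;> simp
  refine (congrArg (· * _) hs).trans ?_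
  simp only [Matrix.submatrix_apply]
  ring

/-- The pfaffian of a `4 × 4` skew array. -/
lemma pfaffian_skew_four (a : Fin 4 → Fin 4 → ℂ) :
    pfaffian (n := 2) (skew a) = a 0 1 * a 2 3 - a 0 2 * a 1 3 + a 0 3 * a 1 2 := by
  rw [pfaffian_eq_pairSum, pairSum_succ]
  have h : ∀ M : Matrix (Fin 2) (Fin 2) ℂ, (pairSum (n := 1) fun _ => M) = M 0 1 - M 1 0 := by
    intro M
    rw [pairSum_succ]
    simp [pairSum, Fin.sum_univ_succ, sub_eq_add_neg]
  simp [Fin.sum_univ_succ, skipPair, skew, swap_apply_def, Matrix.submatrix, h]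
  ring

/-! ### Perturbation of pfaffians, and vanishing for odd blocks -/

/-- Replacing the matrix by one of small `ℓ¹` norm at the places in `T`. -/
lemma norm_pairSum_ite_le {n : ℕ} {M₀ : ℝ} (hM₀ : 0 ≤ M₀)
    (M Z : Matrix (Fin (2 * n)) (Fin (2 * n)) ℂ)
    (hM : ∀ (m : ℕ) (f : Fin (2 * m) → Fin (2 * n)), Function.Injective f →
      ‖pfaffian (M.submatrix f f)‖ ≤ M₀) (T : Finset (Fin n)) :
    ‖pairSum fun j => if j ∈ T then Z else M‖ ≤
      (∑ p, ∑ q, ‖Z p q‖) ^ #T * (2 ^ (n - #T) * (n - #T).factorial * M₀) := by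
  -- The hypothesis on `M` passes to submatrices along injections, so one place of `T` can be
  -- expanded at a time, each costing a factor of at most the `ℓ¹` norm of `Z`. When `T` is
  -- exhausted, a multiple of a sub-pfaffian of `M` remains.
  induction n with
  | zero =>
    have hT : T = ∅ := Finset.eq_empty_of_isEmpty T
    subst hT
    have h := hM 0 id Function.injective_id
    have h2 : (pairSum fun j : Fin 0 => if j ∈ (∅ : Finset (Fin 0)) then Z else M)
      = pfaffian M := by
      rw [pfaffian_eq_pairSum]
      simp
    rw [h2]
    simpa using h
  | succ n ih =>
    rcases T.eq_empty_or_nonempty with rfl | ⟨k, hk⟩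
    · have h := hM (n + 1) id Function.injective_id
      simp only [notMem_empty, if_false, pairSum_const, card_empty, pow_zero, one_mul,
        Nat.sub_zero, norm_mul, norm_pow, Complex.norm_natCast, Complex.norm_ofNat]
      exact mul_le_mul_of_nonneg_left (by simpa using h) (by positivity)
    -- A place `k` of `T` is moved to the front; `T'` records the other places of `T` after this
    -- exchange and a shift by one.
    · set T' : Finset (Fin n) := univ.filter fun i => swap 0 k i.succ ∈ T with hT'
      have hcard : #T = #T' + 1 := by
        have h1 : T.map (swap 0 k).toEmbedding = insert 0 (T'.map (Fin.succEmb n)) := by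
          ext i
          have h2 : i ∈ T.map (swap 0 k).toEmbedding ↔ swap 0 k i ∈ T := by
            rw [mem_map_equiv, symm_swap]
          rw [h2]
          refine Fin.cases ?_ (fun i => ?_) i
          · simp [hk]
          · simp [hT']
        rw [← card_map (swap 0 k).toEmbedding, h1, card_insert_of_notMem, card_map]
        simp
      have hle : n + 1 - #T = n - #T' := by omega
      rw [← pairSum_swap _ 0 k, pairSum_succ, hcard] 
      rw [hcard] at hle
      rw [hle, pow_succ']
      set S := ∑ p, ∑ q, ‖Z p q‖ with hS
      set B : ℝ := 2 ^ (n - #T') * (n - #T').factorial * M₀ with hB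
      have hB0 : 0 ≤ B := by positivity
      have hS0 : 0 ≤ S := sum_nonneg fun _ _ => sum_nonneg fun _ _ => norm_nonneg _
      have hsub : ∀ p q, ‖pairSum fun j : Fin n =>
          (if swap 0 k j.succ ∈ T then Z else M).submatrix (skipPair p q) (skipPair p q)‖
          ≤ S ^ #T' * B := by
        intro p q
        have h1 := ih (M.submatrix (skipPair p q) (skipPair p q))
          (Z.submatrix (skipPair p q) (skipPair p q))
          (fun m f hf => by
            rw [Matrix.submatrix_submatrix]
            exact hM m _ ((skipPair_injective p q).comp hf)) T'
        -- Injectivity means that no entry of `Z` is counted twice, so the `ℓ¹` norm cannot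
        -- increase.
        have h2 : ∑ i, ∑ j, ‖Z.submatrix (skipPair p q) (skipPair p q) i j‖ ≤ S := by
          rw [hS, ← Fintype.sum_prod_type', ← Fintype.sum_prod_type']
          have hinj := (skipPair_injective p q).prodMap (skipPair_injective p q)
          refine (sum_map univ ⟨_, hinj⟩ fun x : Fin (2 * n + 2) × Fin (2 * n + 2) =>
            ‖Z x.1 x.2‖).symm.trans_le ?_
          exact sum_le_sum_of_subset_of_nonneg (subset_univ _) fun _ _ _ => norm_nonneg _
        have h3 : (fun j : Fin n => (if swap 0 k j.succ ∈ T then Z else M).submatrix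
            (skipPair p q) (skipPair p q)) = fun j => if j ∈ T'
            then Z.submatrix (skipPair p q) (skipPair p q)
            else M.submatrix (skipPair p q) (skipPair p q) := by
          funext j
          simp only [hT', mem_filter, mem_univ, true_and]
          split_ifs <;> rfl
        rw [h3]
        refine h1.trans (mul_le_mul_of_nonneg_right (pow_le_pow_left₀ ?_ h2 _) hB0)
        exact sum_nonneg fun _ _ => sum_nonneg fun _ _ => norm_nonneg _
      rw [swap_apply_left, if_pos hk]
      calc _ ≤ ∑ p : Fin (2 * n + 2), ∑ q : Fin (2 * n + 1),
            ‖Z p (swap 0 p q.succ)‖ * (S ^ #T' * B) := by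
            refine (norm_sum_le _ _).trans (sum_le_sum fun p _ => (norm_sum_le _ _).trans
              (sum_le_sum fun q _ => ?_))
            rw [norm_mul]
            refine mul_le_mul (le_of_eq ?_) (hsub p q) (norm_nonneg _) (norm_nonneg _)
            split_ifs <;> simp
        _ = (∑ p : Fin (2 * n + 2), ∑ q : Fin (2 * n + 1), ‖Z p (swap 0 p q.succ)‖)
            * (S ^ #T' * B) := by simp only [sum_mul]
        _ ≤ S * (S ^ #T' * B) := by
            refine mul_le_mul_of_nonneg_right (sum_le_sum fun p _ => ?_) (by positivity)
            have hinj : Function.Injective fun q : Fin (2 * n + 1) => swap 0 p q.succ :=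
              fun i j h => by simpa using h
            refine (sum_map univ ⟨_, hinj⟩ fun q => ‖Z p q‖).symm.trans_le ?_
            exact sum_le_sum_of_subset_of_nonneg (subset_univ _) fun _ _ _ => norm_nonneg _
        _ = _ := by ring

/-- If all sub-pfaffians of `M` are bounded by `M₀`, then the pfaffian changes by at most
`M₀ ∑_{k ≥ 1} sᵏ / k!` under a perturbation whose entries have absolute sum `2 s`. -/
lemma norm_pfaffian_add_sub_le {n : ℕ} {M₀ : ℝ} (hM₀ : 0 ≤ M₀)
    (M Z : Matrix (Fin (2 * n)) (Fin (2 * n)) ℂ)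
    (hM : ∀ (m : ℕ) (f : Fin (2 * m) → Fin (2 * n)), Function.Injective f →
      ‖pfaffian (M.submatrix f f)‖ ≤ M₀) :
    ‖pfaffian (M + Z) - pfaffian M‖ ≤
      M₀ * ∑ k ∈ range n, ((∑ p, ∑ q, ‖Z p q‖) / 2) ^ (k + 1) / (k + 1).factorial := by
  set S := ∑ p, ∑ q, ‖Z p q‖ with hS
  -- Multiplying out the product over the pairs: `T` is the set of pairs for which the summand `Z`
  -- is taken.
  have hexp : (pairSum fun _ : Fin n => M + Z)
      = ∑ T ∈ (univ : Finset (Fin n)).powerset, pairSum fun j => if j ∈ T then Z else M := by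
    simp only [pairSum]
    rw [sum_comm]
    refine sum_congr rfl fun π _ => ?_
    rw [← mul_sum]
    congr 1
    simp only [Matrix.add_apply]
    rw [Finset.prod_congr rfl fun j _ => add_comm _ _, Fintype.prod_add, powerset_univ]
    refine sum_congr rfl fun T _ => ?_
    rw [← prod_mul_prod_compl T]
    refine congrArg₂ _ (prod_congr rfl fun j hj => by rw [if_pos hj])
      (prod_congr rfl fun j hj => by rw [if_neg (mem_compl.1 hj)])
  have hdiff : pfaffian (M + Z) - pfaffian M = (2 ^ n * (n.factorial : ℂ))⁻¹ *
      ∑ T ∈ (univ : Finset (Fin n)).powerset.erase ∅,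
        pairSum fun j => if j ∈ T then Z else M := by
    rw [pfaffian_eq_pairSum, pfaffian_eq_pairSum, hexp, ← mul_sub,
      ← add_sum_erase _ _ (empty_mem_powerset _)]
    simp
  set g : ℕ → ℝ := fun k => S ^ k * (2 ^ (n - k) * (n - k).factorial * M₀) with hg
  have hsum : ∑ T ∈ (univ : Finset (Fin n)).powerset.erase ∅, g #T
      = ∑ k ∈ range n, n.choose (k + 1) * g (k + 1) := by
    have h1 := sum_powerset_apply_card (x := (univ : Finset (Fin n))) g
    rw [← add_sum_erase _ _ (empty_mem_powerset _), card_fin, sum_range_succ'] at h1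
    simp only [card_empty, Nat.choose_zero_right, one_smul, nsmul_eq_mul] at h1
    linarith
  have hn : (0 : ℝ) < 2 ^ n * n.factorial := by positivity
  rw [hdiff, norm_mul, norm_inv, norm_mul, norm_pow, Complex.norm_natCast, Complex.norm_ofNat,
    inv_mul_le_iff₀ hn]
  refine (norm_sum_le _ _).trans ((sum_le_sum fun T _ =>
    norm_pairSum_ite_le hM₀ M Z hM T).trans (hsum.trans_le (le_of_eq ?_)))
  rw [mul_sum, mul_sum]
  refine sum_congr rfl fun k hk => ?_
  have hk : k + 1 ≤ n := mem_range.1 hk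
  -- There are `n.choose (k + 1)` sets `T` of size `k + 1`. With the normalization, the factorials
  -- leave 1/(k + 1)! and the powers of two turn the `ℓ¹` norm into half of it.
  have hc : (n.factorial : ℝ) = n.choose (k + 1) * (k + 1).factorial * (n - (k + 1)).factorial := by
    exact_mod_cast (Nat.choose_mul_factorial_mul_factorial hk).symm
  have h2 : (2 : ℝ) ^ n = 2 ^ (n - (k + 1)) * 2 ^ (k + 1) := by
    rw [← pow_add]; congr 1; omega
  rw [hc, h2, hg, div_pow]
  field_simp

/-- The pfaffian vanishes if the matrix does not connect a set of odd size with its complement. -/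
lemma pfaffian_eq_zero_of_odd {n : ℕ} (M : Matrix (Fin (2 * n)) (Fin (2 * n)) ℂ)
    (L : Finset (Fin (2 * n))) (hL : Odd #L)
    (hM : ∀ p q, ¬(p ∈ L ↔ q ∈ L) → M p q = 0) : pfaffian M = 0 := by
  have hpairs : ∀ (n : ℕ) (f : ℕ → ℕ), ∑ i ∈ range (2 * n), f i
      = ∑ j ∈ range n, (f (2 * j) + f (2 * j + 1)) := by
    intro n f
    induction n with
    | zero => simp
    | succ n ih =>
      rw [sum_range_succ, ← ih, show 2 * (n + 1) = 2 * n + 1 + 1 by ring, sum_range_succ,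
        sum_range_succ]
      ring
  rw [pfaffian, sum_eq_zero, mul_zero]
  intro π _
  by_contra hne
  have hprod := right_ne_zero_of_mul hne
  rw [prod_ne_zero_iff] at hprod
  -- In a nonzero term, every pair lies on one side of the partition, so `L` is a union of pairs and
  -- has even size.
  have hiff : ∀ j : Fin n, π ⟨2 * j, by omega⟩ ∈ L ↔ π ⟨2 * j + 1, by omega⟩ ∈ L := fun j => by
    by_contra h
    exact hprod j (mem_univ _) (hM _ _ h)
  have hcard : #L = ∑ i ∈ range (2 * n),
      if h : i < 2 * n then (if π ⟨i, h⟩ ∈ L then 1 else 0) else 0 := by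
    rw [sum_range]
    simp only [Fin.is_lt, dite_true]
    refine Eq.trans ?_ (Equiv.sum_comp π fun i => if i ∈ L then 1 else 0).symm
    simp
  rw [hpairs] at hcard
  refine (Nat.not_even_iff_odd.2 hL) ?_
  rw [hcard]
  refine even_sum _ fun j hj => ?_
  have hj : j < n := mem_range.1 hj
  rw [dif_pos (by omega), dif_pos (by omega)]
  have := hiff ⟨j, hj⟩
  simp only at this
  simp only [this]
  exact ⟨_, rfl⟩

/-! ### Majorana fermions and quasi-free functionals -/

lemma star_majorana (ξ : ℤ × Flavor) : star (majorana ξ) = majorana ξ := by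
  obtain ⟨x, _ | _⟩ := ξ
  · refine Subtype.ext ?_
    simp [majorana, annihilation, add_comm]
  · refine Subtype.ext ?_
    simp [majorana, annihilation, star_smul, add_comm, sub_eq_add_neg]

lemma majorana_mul_self (ξ : ℤ × Flavor) : majorana ξ * majorana ξ = 1 := by
  obtain ⟨x, f⟩ := ξ
  have h1 : cr x * cr x = 0 := by
    have h := cr_cr x x
    rwa [← two_smul ℂ, smul_eq_zero_iff_right two_ne_zero] at h
  have h2 : an x * an x = 0 := by
    have h := congrArg star h1
    rwa [star_mul, star_cr, star_zero] at h
  have h3 : an x * cr x + cr x * an x = 1 := by simpa using an_cr x x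
  cases f
  · refine Subtype.ext ?_
    change (creation (delta x) + annihilation (delta x)) *
      (creation (delta x) + annihilation (delta x)) = 1
    rw [creation_delta, annihilation_delta, add_mul, mul_add, mul_add, h1, h2, ← h3]
    abel
  · refine Subtype.ext ?_
    change Complex.I • (creation (delta x) - annihilation (delta x)) *
      Complex.I • (creation (delta x) - annihilation (delta x)) = 1
    rw [creation_delta, annihilation_delta, smul_mul_smul_comm, Complex.I_mul_I, sub_mul, mul_sub,
      mul_sub, h1, h2, ← h3, neg_one_smul]
    abel

lemma norm_one_le : ‖(1 : carAlgebra)‖ ≤ 1 := by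
  change ‖((1 : carAlgebra) : Fock →L[ℂ] Fock)‖ ≤ 1
  rw [OneMemClass.coe_one]
  exact ContinuousLinearMap.norm_id_le

/-- The C*-identity gives ‖u‖² = ‖1‖ ≤ 1. -/
lemma norm_le_one_of_star_mul_self {u : carAlgebra} (h : star u * u = 1) : ‖u‖ ≤ 1 := by
  have h1 : star (u : Fock →L[ℂ] Fock) * u = 1 := congrArg Subtype.val h
  have h2 : ‖star (u : Fock →L[ℂ] Fock) * u‖ = ‖(u : Fock →L[ℂ] Fock)‖ * ‖(u : Fock →L[ℂ] Fock)‖ :=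
    ContinuousLinearMap.norm_adjoint_comp_self _
  rw [h1] at h2
  have h3 : ‖(1 : Fock →L[ℂ] Fock)‖ ≤ 1 := ContinuousLinearMap.norm_id_le
  change ‖(u : Fock →L[ℂ] Fock)‖ ≤ 1
  nlinarith [norm_nonneg (u : Fock →L[ℂ] Fock)]

/-- A Majorana fermion is a self-adjoint unitary, a purely algebraic property which a *-automorphism
preserves. -/
lemma norm_evolved_majorana_le (σ : carAlgebra ≃⋆ₐ[ℂ] carAlgebra) (ξ : ℤ × Flavor) :
    ‖σ (majorana ξ)‖ ≤ 1 := by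
  refine norm_le_one_of_star_mul_self ?_
  rw [← map_star, ← map_mul, star_majorana, majorana_mul_self, map_one]

lemma norm_list_prod_le_one (l : List carAlgebra) (h : ∀ u ∈ l, ‖u‖ ≤ 1) : ‖l.prod‖ ≤ 1 := by
  induction l with
  | nil => exact norm_one_le
  | cons u l ih =>
    rw [List.prod_cons]
    refine (norm_mul_le _ _).trans (mul_le_one₀ (h u (by simp)) (norm_nonneg _)
      (ih fun v hv => h v (by simp [hv])))

variable {ω : carAlgebra →ₗ[ℂ] ℂ} {τ : ℝ → carAlgebra ≃⋆ₐ[ℂ] carAlgebra}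

/-- The bound of a quasi-free functional controls all pfaffians of correlations. -/
lemma IsQuasiFree.norm_pfCorrelation_le (h : IsQuasiFree ω τ) {M₀ : ℝ} (hM₀ : 0 ≤ M₀)
    (hω : ∀ A : carAlgebra, ‖ω A‖ ≤ M₀ * ‖A‖) {n : ℕ} (hn : 1 ≤ n)
    (ξ : Fin (2 * n) → ℤ × Flavor) (t : Fin (2 * n) → ℝ) : ‖pfCorrelation ω τ ξ t‖ ≤ M₀ := by
  rw [← h n hn]
  refine (hω _).trans (mul_le_of_le_one_right hM₀ (norm_list_prod_le_one _ fun u hu => ?_))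
  obtain ⟨j, rfl⟩ := (List.mem_ofFn' _ _).1 hu
  exact norm_evolved_majorana_le _ _

/-- Wick's theorem for the modes ξ, η, η, η at times s, t, t, t: since the square of a Majorana
fermion is 1, the left side is the two-point function. On the right, the three pairings have equal
values and signs +, -, +, so one of them survives. -/
lemma IsQuasiFree.two_point_mul_one (h : IsQuasiFree ω τ) (ξ η : ℤ × Flavor) (s t : ℝ) :
    ω (τ s (majorana ξ) * τ t (majorana η))
      = ω (τ s (majorana ξ) * τ t (majorana η)) * ω 1 := by
  have h1 : ∀ ζ r, τ r (majorana ζ) * τ r (majorana ζ) = 1 := fun ζ r => by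
    rw [← map_mul, majorana_mul_self, map_one]
  have h4 := h 2 one_le_two ![ξ, η, η, η] ![s, t, t, t]
  rw [pfCorrelation, pfaffian_skew_four] at h4
  simpa [List.ofFn_succ, h1] using h4

/-- A quasi-free functional is normalized unless its correlations vanish. -/
lemma IsQuasiFree.map_one_or (h : IsQuasiFree ω τ) : ω 1 = 1 ∨
    ∀ ξ η s t, ω (τ s (majorana ξ) * τ t (majorana η)) = 0 := by
  by_cases h1 : ω 1 = 1
  · exact Or.inl h1
  · refine Or.inr fun ξ η s t => ?_
    have h2 : ω (τ s (majorana ξ) * τ t (majorana η)) * (1 - ω 1) = 0 := by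
      rw [mul_sub, mul_one, ← h.two_point_mul_one, sub_self]
    exact (mul_eq_zero.1 h2).resolve_right fun h3 => h1 (sub_eq_zero.1 h3).symm

/-- Monotonicity matters because `skew` decides by the order of the indices whether an entry gets a
minus sign. -/
lemma skew_submatrix {m k : ℕ} (a : Fin m → Fin m → ℂ) {f : Fin k → Fin m} (hf : StrictMono f) :
    (skew a).submatrix f f = skew fun i j => a (f i) (f j) := by
  ext i j
  simp [skew, hf.lt_iff_lt]

lemma pfaffian_zero {n : ℕ} (hn : 1 ≤ n) :
    pfaffian (0 : Matrix (Fin (2 * n)) (Fin (2 * n)) ℂ) = 0 := by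
  have : Nonempty (Fin n) := ⟨⟨0, hn⟩⟩
  simp [pfaffian, zero_pow (by omega : n ≠ 0)]

/-- All sub-pfaffians of a correlation matrix of a normalized quasi-free functional are bounded. -/
lemma IsQuasiFree.norm_pfaffian_submatrix_le (h : IsQuasiFree ω τ) {M₀ : ℝ} (hM₀ : 1 ≤ M₀)
    (hω : ∀ A : carAlgebra, ‖ω A‖ ≤ M₀ * ‖A‖) {n : ℕ}
    (ξ : Fin (2 * n) → ℤ × Flavor) (t : Fin (2 * n) → ℝ) {m : ℕ} (f : Fin (2 * m) → Fin (2 * n))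
    (hf : Function.Injective f) :
    ‖pfaffian ((skew fun j k => ω (τ (t j) (majorana (ξ j)) * τ (t k) (majorana (ξ k)))).submatrix
      f f)‖ ≤ M₀ := by
  -- The empty pfaffian equals 1, which is why `1 ≤ M₀` is required.
  rcases Nat.eq_zero_or_pos m with rfl | hm
  · simpa [pfaffian] using hM₀
  -- Sorting the selected indices costs at most a sign and makes the submatrix the correlation array
  -- of a subfamily, to which Wick's theorem applies.
  have hmono : StrictMono (f ∘ Tuple.sort f) :=
    (Tuple.monotone_sort f).strictMono_of_injective (hf.comp (Equiv.injective _))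
  rw [← norm_pfaffian_submatrix_perm _ (Tuple.sort f), Matrix.submatrix_submatrix,
    skew_submatrix _ hmono]
  exact h.norm_pfCorrelation_le (zero_le_one.trans hM₀) hω hm (ξ ∘ f ∘ Tuple.sort f)
    (t ∘ f ∘ Tuple.sort f)

/-! ### Decay across a gap -/

instance : Fintype Flavor where
  elems := ⟨{Flavor.plus, Flavor.minus}, by simp⟩
  complete a := by cases a <;> simp

lemma card_flavor : Fintype.card Flavor = 2 := rfl

/-- Summation over pairs of Majorana indices on the two sides of an interval `[A, B]`. -/
lemma sum_across_le {ι : Type*} [DecidableEq ι] (ξ : ι → ℤ × Flavor) (hξ : Function.Injective ξ)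
    (L R : Finset ι) (A B : ℤ) (hL : ∀ p ∈ L, (ξ p).1 ≤ A) (hR : ∀ q ∈ R, B ≤ (ξ q).1)
    (g : ℕ → ℝ) (hg : ∀ l, 0 ≤ g l) (hs : Summable fun l : ℕ => (1 + (l : ℝ)) * g l) :
    ∑ x ∈ L ×ˢ R, g ((A - (ξ x.1).1).toNat + ((ξ x.2).1 - B).toNat)
      ≤ 4 * ∑' l : ℕ, (1 + (l : ℝ)) * g l := by
  set key : ι × ι → ℕ := fun x => (A - (ξ x.1).1).toNat + ((ξ x.2).1 - B).toNat with hkey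
  have hfib : ∀ l, (#{x ∈ L ×ˢ R | key x = l} : ℝ) ≤ 4 * (1 + (l : ℝ)) := by
    intro l
    -- A pair with key `l` is determined by how `l` splits into the two distances from the gap and
    -- by the two flavours: the positions are recovered from the distances, and `ξ` is injective.
    have h1 : #{x ∈ L ×ˢ R | key x = l}
        ≤ #(antidiagonal l ×ˢ (univ : Finset (Flavor × Flavor))) := by
      refine card_le_card_of_injOn (fun x => (((A - (ξ x.1).1).toNat, ((ξ x.2).1 - B).toNat),
        ((ξ x.1).2, (ξ x.2).2))) ?_ ?_
      · intro x hx
        have hx := (mem_filter.1 (mem_coe.1 hx)).2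
        simpa using hx
      · rintro ⟨p, q⟩ hx ⟨p', q'⟩ hx' heq
        simp only [coe_filter, mem_product, Set.mem_ofPred_eq] at hx hx'
        have a1 := hL p hx.1.1
        have a2 := hL p' hx'.1.1
        have a3 := hR q hx.1.2
        have a4 := hR q' hx'.1.2
        simp only [Prod.mk.injEq] at heq
        obtain ⟨⟨b1, b2⟩, b3, b4⟩ := heq
        rw [Prod.mk.injEq]
        exact ⟨hξ (Prod.ext (by omega) b3), hξ (Prod.ext (by omega) b4)⟩
    rw [card_product, Nat.card_antidiagonal, card_univ, Fintype.card_prod, card_flavor] at h1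
    have h2 : (#{x ∈ L ×ˢ R | key x = l} : ℝ) ≤ ((l + 1) * (2 * 2) : ℕ) := by exact_mod_cast h1
    push_cast at h2
    linarith
  calc ∑ x ∈ L ×ˢ R, g (key x)
      = ∑ l ∈ (L ×ˢ R).image key, ∑ x ∈ L ×ˢ R with key x = l, g (key x) :=
        (sum_fiberwise_of_maps_to (fun x hx => mem_image_of_mem key hx) _).symm
    _ = ∑ l ∈ (L ×ˢ R).image key, #{x ∈ L ×ˢ R | key x = l} * g l := by
        refine sum_congr rfl fun l _ => ?_
        rw [sum_congr rfl fun x hx => by rw [(mem_filter.1 hx).2], sum_const, nsmul_eq_mul]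
    _ ≤ ∑ l ∈ (L ×ˢ R).image key, 4 * ((1 + (l : ℝ)) * g l) := by
        refine sum_le_sum fun l _ => ?_
        rw [← mul_assoc]
        exact mul_le_mul_of_nonneg_right (hfib l) (hg l)
    _ ≤ 4 * ∑' l : ℕ, (1 + (l : ℝ)) * g l := by
        rw [← mul_sum]
        exact mul_le_mul_of_nonneg_left
          (hs.sum_le_tsum _ fun l _ => mul_nonneg (by positivity) (hg l)) (by norm_num)

/-- Sorted points have a gap of length `pairDist x` with an odd number of points on either side. -/
lemma exists_gap {n : ℕ} (hn : 1 ≤ n) (x : Fin (2 * n) → ℤ) :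
    ∃ (L : Finset (Fin (2 * n))) (A B : ℤ), Odd #L ∧ (∀ p ∈ L, x p ≤ A) ∧ (∀ q ∉ L, B ≤ x q) ∧
      A + pairDist x = B := by
  have : Nonempty (Fin n) := ⟨⟨0, hn⟩⟩
  obtain ⟨j, -, hj⟩ := exists_mem_eq_sup (univ : Finset (Fin n)) univ_nonempty fun j : Fin n =>
    (x (Tuple.sort x ⟨2 * j + 1, by omega⟩) - x (Tuple.sort x ⟨2 * j, by omega⟩)).natAbs
  have hmono : ∀ i k : Fin (2 * n), i ≤ k → x (Tuple.sort x i) ≤ x (Tuple.sort x k) :=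
    fun i k hik => Tuple.monotone_sort x hik
  -- With indices from 0, the left side consists of the sorted places 0, …, 2j, an odd number of
  -- them.
  refine ⟨(Iic (⟨2 * j, by omega⟩ : Fin (2 * n))).map (Tuple.sort x).toEmbedding,
    x (Tuple.sort x ⟨2 * j, by omega⟩), x (Tuple.sort x ⟨2 * j + 1, by omega⟩), ?_, ?_, ?_, ?_⟩
  · rw [card_map, Fin.card_Iic]
    exact ⟨j, rfl⟩
  · intro p hp
    rw [mem_map_equiv, mem_Iic] at hp
    simpa using hmono _ _ hp
  · intro q hq
    rw [mem_map_equiv, mem_Iic, not_le, Fin.lt_def] at hq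
    simpa using hmono ⟨2 * j + 1, by omega⟩ _ (Fin.le_def.2 hq)
  · have h := hmono ⟨2 * j, by omega⟩ ⟨2 * j + 1, by omega⟩ (Fin.le_def.2 (by simp))
    have h2 : pairDist x = _ := hj
    rw [h2]
    omega

/-- By monotonicity `K (r + l)` dominates both `K r` and `K l`. The weight `μ - μ₀` is spent on the
first to give the final decay, and `μ₀` on the second to keep the sum over `l` finite. -/
lemma exp_decay_le {K : ℝ≥0 → ℝ≥0} (hK : Monotone K) {μ₀ μ : ℝ} (hμ₀ : 0 < μ₀) (hμ : μ₀ < μ)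
    (r l : ℕ) : Real.exp (-μ * (K ((r + l : ℕ) : ℝ≥0) : ℝ)) ≤
      Real.exp (-(μ - μ₀) * (K (r : ℝ≥0) : ℝ)) * Real.exp (-μ₀ * (K (l : ℝ≥0) : ℝ)) := by
  have h1 : (K (r : ℝ≥0) : ℝ) ≤ K ((r + l : ℕ) : ℝ≥0) := by
    exact_mod_cast hK (by exact_mod_cast Nat.le_add_right r l)
  have h2 : (K (l : ℝ≥0) : ℝ) ≤ K ((r + l : ℕ) : ℝ≥0) := by
    exact_mod_cast hK (by exact_mod_cast Nat.le_add_left l r)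
  rw [← Real.exp_add, Real.exp_le_exp]
  nlinarith [mul_le_mul_of_nonneg_left h1 (sub_pos.2 hμ).le, mul_le_mul_of_nonneg_left h2 hμ₀.le]

/-- The sum has no constant term, so every summand contains a factor ε; the other powers of ε are at
most 1. -/
lemma sum_pow_div_factorial_le {κ ε : ℝ} (hκ : 0 ≤ κ) (hε : 0 ≤ ε) (hε1 : ε ≤ 1) (n : ℕ) :
    ∑ k ∈ range n, (ε * κ) ^ (k + 1) / (k + 1).factorial ≤ ε * Real.exp κ := by
  calc ∑ k ∈ range n, (ε * κ) ^ (k + 1) / (k + 1).factorial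
      ≤ ∑ k ∈ range n, ε * (κ ^ (k + 1) / (k + 1).factorial) := by
        refine sum_le_sum fun k _ => ?_
        rw [← mul_div_assoc, mul_pow]
        gcongr
        exact pow_le_of_le_one hε hε1 (Nat.succ_ne_zero k)
    _ = ε * ∑ k ∈ range n, κ ^ (k + 1) / (k + 1).factorial := by rw [mul_sum]
    _ ≤ ε * ∑ k ∈ range (n + 1), κ ^ k / k.factorial := by
        refine mul_le_mul_of_nonneg_left ?_ hε
        rw [sum_range_succ' _ n]
        simp
    _ ≤ ε * Real.exp κ := mul_le_mul_of_nonneg_left (Real.sum_le_exp_of_nonneg hκ _) hε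

/-! ### The decay estimate -/

/-- A matrix indexed by distinct Majorana modes with bounded sub-pfaffians and decaying entries has
a pfaffian which decays in the distance of the paired points. -/
lemma norm_pfaffian_le_of_decay {K : ℝ≥0 → ℝ≥0} (hK : Monotone K) {μ₀ μ C M₀ : ℝ} (hμ₀ : 0 < μ₀)
    (hI : Summable fun l : ℕ => (1 + (l : ℝ)) * Real.exp (-μ₀ * (K (l : ℝ≥0) : ℝ)))
    (hC : 0 < C) (hM₀ : 0 < M₀) (hμ : μ₀ < μ) {n : ℕ} (hn : 1 ≤ n)
    (ξ : Fin (2 * n) → ℤ × Flavor) (hξ : Function.Injective ξ)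
    (M : Matrix (Fin (2 * n)) (Fin (2 * n)) ℂ)
    (hM : ∀ (m : ℕ) (f : Fin (2 * m) → Fin (2 * n)), Function.Injective f →
      ‖pfaffian (M.submatrix f f)‖ ≤ M₀)
    (hentry : ∀ p q, ‖M p q‖
      ≤ C * Real.exp (-μ * (K (((ξ p).1 - (ξ q).1).natAbs : ℝ≥0) : ℝ))) :
    ‖pfaffian M‖ ≤ M₀ *
      Real.exp (C * (4 * ∑' l : ℕ, (1 + (l : ℝ)) * Real.exp (-μ₀ * (K (l : ℝ≥0) : ℝ)))) *
      Real.exp (-(μ - μ₀) * (K (pairDist (fun j => (ξ j).1) : ℝ≥0) : ℝ)) := by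
  set D : ℝ := ∑' l : ℕ, (1 + (l : ℝ)) * Real.exp (-μ₀ * (K (l : ℝ≥0) : ℝ)) with hD
  have hD0 : 0 ≤ D := tsum_nonneg fun l => by positivity
  set κ : ℝ := C * (4 * D) with hκ
  have hκ0 : 0 ≤ κ := by positivity
  set x : Fin (2 * n) → ℤ := fun j => (ξ j).1 with hx
  obtain ⟨L, A, B, hodd, hLA, hRB, hAB⟩ := exists_gap hn x
  set r := pairDist x with hr
  set ε : ℝ := Real.exp (-(μ - μ₀) * (K (r : ℝ≥0) : ℝ)) with hε
  have hε1 : ε ≤ 1 := by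
    rw [hε, Real.exp_le_one_iff, neg_mul, neg_nonpos]
    exact mul_nonneg (sub_pos.2 hμ).le (NNReal.coe_nonneg _)
  set g : ℕ → ℝ := fun l => Real.exp (-μ₀ * (K (l : ℝ≥0) : ℝ)) with hg
  set key : Fin (2 * n) → Fin (2 * n) → ℕ := fun p q => (A - x p).toNat + (x q - B).toNat with hkey
  have hcross : ∀ p ∈ L, ∀ q ∈ Lᶜ, ‖M p q‖ ≤ C * (ε * g (key p q)) ∧
      ‖M q p‖ ≤ C * (ε * g (key p q)) := by
    intro p hp q hq
    have hp' := hLA p hp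
    have hq' := hRB q (mem_compl.1 hq)
    -- The whole gap lies between `x p` and `x q`, so their distance is exactly its length plus the
    -- two outer distances.
    have e1 : (x p - x q).natAbs = r + key p q := by simp only [hkey]; omega
    have e2 : (x q - x p).natAbs = r + key p q := by simp only [hkey]; omega
    have hb := mul_le_mul_of_nonneg_left (exp_decay_le hK hμ₀ hμ r (key p q)) hC.le
    exact ⟨(hentry p q).trans (by rw [e1]; exact hb), (hentry q p).trans (by rw [e2]; exact hb)⟩
  -- Adding `Z` deletes exactly the entries that connect the two sides of the gap.
  set Z : Matrix (Fin (2 * n)) (Fin (2 * n)) ℂ := Matrix.of fun p q =>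
    if p ∈ L ↔ q ∈ L then 0 else -M p q with hZ
  have hsum : ∑ p ∈ L, ∑ q ∈ Lᶜ, C * (ε * g (key p q)) ≤ ε * κ := by
    have h := sum_across_le ξ hξ L Lᶜ A B hLA (fun q hq => hRB q (mem_compl.1 hq)) g
      (fun l => (Real.exp_pos _).le) hI
    rw [sum_product] at h
    simp only [← mul_sum]
    calc _ = C * ε * ∑ p ∈ L, ∑ q ∈ Lᶜ, g (key p q) := by ring
      _ ≤ C * ε * (4 * D) := mul_le_mul_of_nonneg_left h (by positivity)
      _ = ε * κ := by rw [hκ]; ring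
  have hZsum : (∑ p, ∑ q, ‖Z p q‖) / 2 ≤ ε * κ := by
    -- The two off-diagonal blocks each contribute at most `ε * κ`; the factor 1/2 compensates for
    -- having two of them.
    have hsplit : ∑ p, ∑ q, ‖Z p q‖ = ∑ p ∈ L, ∑ q ∈ Lᶜ, ‖M p q‖ + ∑ p ∈ L, ∑ q ∈ Lᶜ, ‖M q p‖ := by
      rw [sum_comm (f := fun p q => ‖M q p‖), ← sum_add_sum_compl L]
      refine congrArg₂ _ (sum_congr rfl fun p hp => ?_) (sum_congr rfl fun p hp => ?_)
      · rw [← sum_add_sum_compl L, sum_eq_zero, zero_add]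
        · exact sum_congr rfl fun q hq => by simp [hZ, hp, mem_compl.1 hq]
        · exact fun q hq => by simp [hZ, hp, hq]
      · rw [← sum_add_sum_compl L, add_comm, sum_eq_zero, zero_add]
        · exact sum_congr rfl fun q hq => by simp [hZ, hq, mem_compl.1 hp]
        · exact fun q hq => by simp [hZ, mem_compl.1 hp, mem_compl.1 hq]
    have ha := sum_le_sum fun p hp => sum_le_sum fun q hq => (hcross p hp q hq).1
    have hb := sum_le_sum fun p hp => sum_le_sum fun q hq => (hcross p hp q hq).2
    rw [hsplit]
    linarith
  have hpf0 : pfaffian (M + Z) = 0 := by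
    refine pfaffian_eq_zero_of_odd _ L hodd fun p q hpq => ?_
    simp [hZ, hpq]
  have hmain := norm_pfaffian_add_sub_le hM₀.le M Z hM
  rw [hpf0, zero_sub, norm_neg] at hmain
  rw [mul_assoc, mul_comm (Real.exp κ)]
  refine hmain.trans (mul_le_mul_of_nonneg_left (le_trans (sum_le_sum fun k _ => ?_)
    (sum_pow_div_factorial_le hκ0 (Real.exp_pos _).le hε1 n)) hM₀.le)
  gcongr

lemma IsQuasiFree.norm_pfCorrelation_le_of_decay (h : IsQuasiFree ω τ) {M₀ : ℝ} (hM₀ : 0 < M₀)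
    (hω : ∀ A : carAlgebra, ‖ω A‖ ≤ M₀ * ‖A‖) {K : ℝ≥0 → ℝ≥0} (hK : Monotone K) {μ₀ μ C : ℝ}
    (hμ₀ : 0 < μ₀)
    (hI : Summable fun l : ℕ => (1 + (l : ℝ)) * Real.exp (-μ₀ * (K (l : ℝ≥0) : ℝ)))
    (hC : 0 < C) (hμ : μ₀ < μ) {n : ℕ} (hn : 1 ≤ n)
    (ξ : Fin (2 * n) → ℤ × Flavor) (hξ : Function.Injective ξ) (t : Fin (2 * n) → ℝ)
    (hdecay : ∀ p q, ‖ω (τ (t p) (majorana (ξ p)) * τ (t q) (majorana (ξ q)))‖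
      ≤ C * Real.exp (-μ * (K (((ξ p).1 - (ξ q).1).natAbs : ℝ≥0) : ℝ))) :
    ‖pfCorrelation ω τ ξ t‖ ≤ M₀ *
      Real.exp (C * (4 * ∑' l : ℕ, (1 + (l : ℝ)) * Real.exp (-μ₀ * (K (l : ℝ≥0) : ℝ)))) *
      Real.exp (-(μ - μ₀) * (K (pairDist (fun j => (ξ j).1) : ℝ≥0) : ℝ)) := by
  -- If all two-point functions vanish, so does the pfaffian. Otherwise `ω 1 = 1`, and the norm
  -- bound at the identity forces `1 ≤ M₀`, as the sub-pfaffian bound needs.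
  rcases h.map_one_or with h1 | h0
  swap
  · have hz : (skew fun j k => ω (τ (t j) (majorana (ξ j)) * τ (t k) (majorana (ξ k)))) = 0 := by
      ext j k
      simp [skew, h0]
    rw [pfCorrelation, hz, pfaffian_zero hn, norm_zero]
    positivity
  have hM₀1 : 1 ≤ M₀ := by
    have h := hω 1
    rw [h1, norm_one] at h
    exact h.trans (mul_le_of_le_one_right hM₀.le norm_one_le)
  refine norm_pfaffian_le_of_decay hK hμ₀ hI hC hM₀ hμ hn ξ hξ _
    (fun m f hf => h.norm_pfaffian_submatrix_le hM₀1 hω ξ t f hf) fun p q => ?_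
  simp only [skew, Matrix.of_apply]
  split_ifs with hpq hqp
  · exact hdecay p q
  -- Below the diagonal the entry is minus the correlation in the opposite order, which has the same
  -- decay because the distance is symmetric.
  · rw [norm_neg, ← Int.natAbs_neg, neg_sub]
    exact hdecay q p
  · rw [norm_zero]; positivity

end CAR

end

theorem theorem3 (K : ℝ≥0 → ℝ≥0) (hK : Monotone K) (μ₀ : ℝ) (hμ₀ : 0 < μ₀)
    (hI : Summable fun l : ℕ => (1 + (l : ℝ)) * Real.exp (-μ₀ * (K (l : ℝ≥0) : ℝ)))
    (C : ℝ) (hC : 0 < C) :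
    ∃ C' : ℝ, 0 < C' ∧
      ∀ (ω : CAR.carAlgebra →ₗ[ℂ] ℂ) (τ : ℝ → CAR.carAlgebra ≃⋆ₐ[ℂ] CAR.carAlgebra),
        CAR.IsQuasiFree ω τ →
      ∀ M₀ : ℝ, 0 < M₀ → (∀ A : CAR.carAlgebra, ‖ω A‖ ≤ M₀ * ‖A‖) →
      ∀ (I : Set ℝ) (μ : ℝ), μ₀ < μ →
        (∀ (x y : ℤ) (a b : CAR.Flavor), ∀ s ∈ I, ∀ t ∈ I,
          ‖ω (τ t (CAR.majorana (x, a)) * τ s (CAR.majorana (y, b)))‖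
            ≤ C * Real.exp (-μ * (K ((x - y).natAbs : ℝ≥0) : ℝ))) →
      ∀ n : ℕ, 1 ≤ n → ∀ ξ : Fin (2 * n) → ℤ × CAR.Flavor, Function.Injective ξ →
        ∀ t : Fin (2 * n) → ℝ, (∀ j, t j ∈ I) →
          ‖CAR.pfCorrelation ω τ ξ t‖
            ≤ M₀ * C' * Real.exp
                (-(μ - μ₀) * (K (CAR.pairDist (fun j => (ξ j).1) : ℝ≥0) : ℝ)) := by
  -- The constant is exp κ; the 4 counts the pairs of flavours.
  refine ⟨Real.exp (C * (4 * ∑' l : ℕ, (1 + (l : ℝ)) * Real.exp (-μ₀ * (K (l : ℝ≥0) : ℝ)))),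
    Real.exp_pos _, fun ω τ hqf M₀ hM₀ hω I μ hμ hdecay n hn ξ hξ t ht => ?_⟩
  exact hqf.norm_pfCorrelation_le_of_decay hM₀ hω hK hμ₀ hI hC hμ hn ξ hξ t fun p q =>
    hdecay _ _ _ _ _ (ht q) _ (ht p)
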